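/- For $L>0$ and a bounded measurable $v:\mathbb{R}\to[0,\infty)$, let $h^D_L=-\frac{d^2}{dx^2}+v$ be the Schrödinger operator on $L^2((-L/2,L/2))$ with Dirichlet boundary conditions at $x=\pm L/2$, i.e. with domain $H^2((-L/2,L/2))\cap H^1_0((-L/2,L/2))$. Let $\varepsilon_0(L)\le\varepsilon_1(L)\le\dots$ be its eigenvalues in increasing order, counted with multiplicity, and let $\Gamma_v(L):=\varepsilon_1(L)-\varepsilon_0(L)$ be its spectral gap. Proposition. Let $v_0,b>0$ and let $v:=v_0\cdot\mathbf 1_{[-b,b]}$ be the step potential. Then there are constants $\alpha,\beta>0$ (depending only on $v_0$ and $b$) such that for all sufficiently large $L>0$ the two lowest eigenvalues $\varepsilon_0(L),\varepsilon_1(L)$ exist and $$\frac{\alpha}{L^3}\le\Gamma_v(L)\le\frac{\beta}{L^3}.$$ -/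

import Mathlib

open MeasureTheory

noncomputable section

/-- The complex Hilbert space `L²((-L/2, L/2))`. -/
abbrev L2Interval (L : ℝ) : Type :=
  Lp ℂ 2 (volume.restrict (Set.Ioo (-(L / 2)) (L / 2)))

/-- `u : [-L/2, L/2] → ℂ` is of class `C¹` with derivative `u₁`, the function `u₁` is absolutely
continuous on `[-L/2, L/2]` with almost everywhere derivative `w`, and `u` satisfies the
Dirichlet conditions `u (-L/2) = u (L/2) = 0`. For `w` in `L²` this says that `u` belongs to
`H²((-L/2, L/2)) ∩ H¹₀((-L/2, L/2))`, with `u' = u₁` and `u'' = w`. -/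
structure IsDirichletH2 (L : ℝ) (u u₁ w : ℝ → ℂ) : Prop where
  hasDeriv : ∀ x ∈ Set.Icc (-(L / 2)) (L / 2),
    HasDerivWithinAt u (u₁ x) (Set.Icc (-(L / 2)) (L / 2)) x
  ac : AbsolutelyContinuousOnInterval u₁ (-(L / 2)) (L / 2)
  hasDeriv₂ : ∀ᵐ x ∂(volume.restrict (Set.Ioo (-(L / 2)) (L / 2))), HasDerivAt u₁ (w x) x
  left_eq_zero : u (-(L / 2)) = 0
  right_eq_zero : u (L / 2) = 0

/-- The graph of `h = -d²/dx² + v` on `L²((-L/2, L/2))` with Dirichlet boundary conditions at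
`±L/2`: all pairs `(u, -u'' + v u)` with `u ∈ H² ∩ H¹₀`. -/
def dirichletGraph (v : ℝ → ℝ) (L : ℝ) : Submodule ℂ (L2Interval L × L2Interval L) where
  carrier := {p | ∃ (u u₁ : ℝ → ℂ) (w : L2Interval L), IsDirichletH2 L u u₁ w ∧
    (∀ᵐ x ∂(volume.restrict (Set.Ioo (-(L / 2)) (L / 2))), p.1 x = u x) ∧
    (∀ᵐ x ∂(volume.restrict (Set.Ioo (-(L / 2)) (L / 2))), p.2 x = -w x + (v x : ℂ) * u x)}
  zero_mem' := by
    refine ⟨0, 0, 0, ⟨?_, ?_, ?_, rfl, rfl⟩, ?_, ?_⟩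
    · intro x _
      exact hasDerivWithinAt_const x _ (0 : ℂ)
    · have := (LipschitzWith.const (α := ℝ) (0 : ℂ)).lipschitzOnWith
        (s := Set.uIcc (-(L / 2)) (L / 2))
      exact this.absolutelyContinuousOnInterval
    · filter_upwards [Lp.coeFn_zero ℂ 2 (volume.restrict (Set.Ioo (-(L / 2)) (L / 2)))] with x hx
      rw [hx]
      exact hasDerivAt_const x (0 : ℂ)
    · filter_upwards [Lp.coeFn_zero ℂ 2 (volume.restrict (Set.Ioo (-(L / 2)) (L / 2)))] with x hx
      exact hx
    · filter_upwards [Lp.coeFn_zero ℂ 2 (volume.restrict (Set.Ioo (-(L / 2)) (L / 2)))] with x hx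
      simp only [Prod.snd_zero, Pi.zero_apply, mul_zero, add_zero]
      rw [hx, Pi.zero_apply, neg_zero]
  add_mem' := by
    rintro ⟨f, g⟩ ⟨f', g'⟩ ⟨u, u₁, w, h, hf, hg⟩ ⟨u', u₁', w', h', hf', hg'⟩
    refine ⟨u + u', u₁ + u₁', w + w', ⟨?_, h.ac.add h'.ac, ?_, ?_, ?_⟩, ?_, ?_⟩
    · intro x hx
      exact (h.hasDeriv x hx).add (h'.hasDeriv x hx)
    · filter_upwards [h.hasDeriv₂, h'.hasDeriv₂, Lp.coeFn_add w w'] with x h1 h2 h3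
      rw [h3]
      exact h1.add h2
    · simp [h.left_eq_zero, h'.left_eq_zero]
    · simp [h.right_eq_zero, h'.right_eq_zero]
    · filter_upwards [hf, hf', Lp.coeFn_add f f'] with x h1 h2 h3
      simp only [Prod.mk_add_mk, h3, Pi.add_apply, h1, h2]
    · filter_upwards [hg, hg', Lp.coeFn_add g g', Lp.coeFn_add w w'] with x h1 h2 h3 h4
      simp only [Prod.mk_add_mk, h3, h4, Pi.add_apply, h1, h2]
      ring
  smul_mem' := by
    rintro c ⟨f, g⟩ ⟨u, u₁, w, h, hf, hg⟩
    refine ⟨c • u, c • u₁, c • w, ⟨?_, h.ac.const_smul c, ?_, ?_, ?_⟩, ?_, ?_⟩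
    · intro x hx
      exact (h.hasDeriv x hx).const_smul c
    · filter_upwards [h.hasDeriv₂, Lp.coeFn_smul c w] with x h1 h3
      rw [h3]
      exact h1.const_smul c
    · simp [h.left_eq_zero]
    · simp [h.right_eq_zero]
    · filter_upwards [hf, Lp.coeFn_smul c f] with x h1 h3
      simp [h3, h1]
    · filter_upwards [hg, Lp.coeFn_smul c g, Lp.coeFn_smul c w] with x h1 h3 h4
      simp only [Prod.smul_mk, h3, h4, Pi.smul_apply, h1, smul_eq_mul]
      ring

/-- `dirichletGraph` is the graph of a single-valued operator. -/
theorem dirichletGraph_single_valued (v : ℝ → ℝ) (L : ℝ) (p : L2Interval L × L2Interval L)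
    (hp : p ∈ dirichletGraph v L) (hp0 : p.1 = 0) : p.2 = 0 := by
  obtain ⟨u, u₁, w, h, hf, hg⟩ := hp
  have hu_ae : ∀ᵐ x ∂(volume.restrict (Set.Ioo (-(L / 2)) (L / 2))), u x = 0 := by
    filter_upwards [hf, Lp.coeFn_zero ℂ 2 (volume.restrict (Set.Ioo (-(L / 2)) (L / 2)))]
      with x h1 h2
    rw [← h1, hp0, h2, Pi.zero_apply]
  have hcont : ContinuousOn u (Set.Ioo (-(L / 2)) (L / 2)) := fun x hx =>
    ((h.hasDeriv x (Set.Ioo_subset_Icc_self hx)).continuousWithinAt).mono Set.Ioo_subset_Icc_self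
  have hu : Set.EqOn u (fun _ => 0) (Set.Ioo (-(L / 2)) (L / 2)) :=
    Measure.eqOn_open_of_ae_eq hu_ae isOpen_Ioo hcont continuousOn_const
  have hu₁ : ∀ x ∈ Set.Ioo (-(L / 2)) (L / 2), u₁ x = 0 := by
    intro x hx
    have h1 : HasDerivAt u (u₁ x) x :=
      (h.hasDeriv x (Set.Ioo_subset_Icc_self hx)).hasDerivAt (Icc_mem_nhds hx.1 hx.2)
    have h2 : HasDerivAt u 0 x := (hasDerivAt_const x (0 : ℂ)).congr_of_eventuallyEq
      (hu.eventuallyEq_of_mem (isOpen_Ioo.mem_nhds hx))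
    exact h1.unique h2
  rw [Lp.eq_zero_iff_ae_eq_zero]
  filter_upwards [hg, hu_ae, h.hasDeriv₂, ae_restrict_mem measurableSet_Ioo] with x h1 h2 h3 hx
  have h4 : HasDerivAt u₁ 0 x := by
    refine (hasDerivAt_const x (0 : ℂ)).congr_of_eventuallyEq ?_
    filter_upwards [isOpen_Ioo.mem_nhds hx] with y hy
    exact hu₁ y hy
  rw [h1, h2, h3.unique h4]
  simp

/-- The Schrödinger operator `-d²/dx² + v` on `L²((-L/2, L/2))` with Dirichlet boundary
conditions at `±L/2`, as an unbounded operator with domain `H² ∩ H¹₀` (for bounded `v`). -/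
def dirichletSchrodinger (v : ℝ → ℝ) (L : ℝ) : L2Interval L →ₗ.[ℂ] L2Interval L :=
  (dirichletGraph v L).toLinearPMap

theorem dirichletSchrodinger_graph (v : ℝ → ℝ) (L : ℝ) :
    (dirichletSchrodinger v L).graph = dirichletGraph v L :=
  Submodule.toLinearPMap_graph_eq _ (dirichletGraph_single_valued v L)

/-- The eigenspace `{f ∈ dom T : T f = μ f}` of an unbounded operator. -/
def LinearPMap.eigenspace {E : Type*} [AddCommGroup E] [Module ℂ E] (T : E →ₗ.[ℂ] E) (μ : ℂ) :
    Submodule ℂ E :=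
  T.graph.comap (LinearMap.id.prod (μ • LinearMap.id))

theorem LinearPMap.mem_eigenspace_iff {E : Type*} [AddCommGroup E] [Module ℂ E]
    (T : E →ₗ.[ℂ] E) (μ : ℂ) (f : E) :
    f ∈ T.eigenspace μ ↔ ∃ hf : f ∈ T.domain, T ⟨f, hf⟩ = μ • f := by
  simp [LinearPMap.eigenspace, LinearPMap.mem_graph_iff]

/-- The set of energies `E` such that `T` has at least `n + 1` eigenvalues in `(-∞, E]`, counted
with multiplicity. -/
def energiesAbove {E : Type*} [AddCommGroup E] [Module ℂ E] (T : E →ₗ.[ℂ] E) (n : ℕ) : Set ℝ :=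
  {t : ℝ | ((n + 1 : ℕ) : Cardinal) ≤
    Module.rank ℂ (⨆ μ : Set.Iic t, T.eigenspace ((μ : ℝ) : ℂ) : Submodule ℂ E)}

/-- The `n`-th eigenvalue `εₙ(L)` (`n = 0, 1, …`) of the Dirichlet operator, in increasing order and
counted with multiplicity: the least energy up to which there are `n + 1` eigenvalues. -/
def dirichletEigenvalue (v : ℝ → ℝ) (L : ℝ) (n : ℕ) : ℝ :=
  sInf (energiesAbove (dirichletSchrodinger v L) n)

/-- The spectral gap `Γ_v(L) = ε₁(L) - ε₀(L)`. -/
def spectralGap (v : ℝ → ℝ) (L : ℝ) : ℝ :=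
  dirichletEigenvalue v L 1 - dirichletEigenvalue v L 0

/-- The step potential `v₀ · 1_{[-b, b]}`. -/
def stepPotential (v₀ b : ℝ) : ℝ → ℝ :=
  (Set.Icc (-b) b).indicator fun _ => v₀

end

/-!
For `E ≤ 0` there is no eigenfunction, because for a nonnegative potential the energy identity
`∫ |u'|² + (v - E) |u|² = 0` forces `u = 0` (`IsSolutionOn.eq_zero_of_nonneg`). For `E = k²` with
`0 < k² < v₀` put `κ = √(v₀ - k²)`. The equation `-u'' + v u = k² u` has an explicit even and an
explicit odd solution (`evenSolution`, `oddSolution`): hyperbolic in the barrier `[-b, b]`, and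
oscillating with wave number `k` outside. Since Wronskians of two solutions are constant, every
solution is a combination of these two, and the Dirichlet conditions at `±L/2` decouple by parity.
Hence `k²` is an eigenvalue precisely if the even or the odd solution vanishes at `L/2`.

With `ℓ = L/2 - b` and with `m(k)` the logarithmic derivative at `b` of the solution in the barrier,
`κ tanh (κ b)` in the even case and `κ / tanh (κ b)` in the odd case, the solution vanishes at `L/2`
when `k cos (k ℓ) + m(k) sin (k ℓ) = 0`. For `0 < k ℓ < π` this is the phase condition
`k ℓ + arctan (k / m(k)) = π` (`matching_iff`). Both slopes `m` decrease in `k`, so that the phase is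
strictly increasing and the condition has exactly one solution `k₀` (even) and `k₁` (odd) in
`(0, π / ℓ)`; the even slope is the smaller one, so `k₀ < k₁`. The two lowest eigenvalues are
therefore `k₀²`, which is simple, and `k₁²` (`exists_lowest_energies`).

Subtracting the two phase conditions gives
`(k₁ - k₀) ℓ = arctan (k₀ / mₑ(k₀)) - arctan (k₁ / mₒ(k₁))`. The right side is at most
`k₀ / mₑ(k₀) = O(1 / ℓ)`. As `mₑ` and `mₒ` stay apart near `k = 0`, it is also at least a constant
times `k₀` up to a term proportional to `k₁ - k₀`, and `k₀ ≥ 1 / ℓ`. So `k₁ - k₀` is of order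
`ℓ⁻²`, and the gap `(k₁ - k₀) (k₁ + k₀)` is of order `ℓ⁻³` (`gap_upper_bound`, `gap_lower_bound`).
-/

noncomputable section

open Set

/-! ### Solutions of `u'' = q u` with absolutely continuous derivative -/

/-- `u` solves `u'' = q u` on `[-a, a]`: it is of class `C¹` there with derivative `u₁`, which is
absolutely continuous with almost everywhere derivative `q u`. No boundary condition is imposed. -/
structure IsSolutionOn (q : ℝ → ℝ) (a : ℝ) (u u₁ : ℝ → ℂ) : Prop where
  hasDeriv : ∀ x ∈ Set.Icc (-a) a, HasDerivWithinAt u (u₁ x) (Set.Icc (-a) a) x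
  ac : AbsolutelyContinuousOnInterval u₁ (-a) a
  hasDeriv₂ : ∀ᵐ x ∂(volume.restrict (Set.Ioo (-a) a)), HasDerivAt u₁ ((q x : ℂ) * u x) x

theorem LipschitzWith.comp_absolutelyContinuousOnInterval {X Y : Type*} [PseudoMetricSpace X]
    [PseudoMetricSpace Y] {K : NNReal} {g : X → Y} (hg : LipschitzWith K g) {f : ℝ → X} {a b : ℝ}
    (hf : AbsolutelyContinuousOnInterval f a b) :
    AbsolutelyContinuousOnInterval (fun x => g (f x)) a b := by
  unfold AbsolutelyContinuousOnInterval at *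
  refine squeeze_zero (fun t => Finset.sum_nonneg fun i _ => dist_nonneg) (fun t => ?_)
    (by simpa using hf.const_mul (K : ℝ))
  rw [Finset.mul_sum]
  exact Finset.sum_le_sum fun i _ => hg.dist_le_mul _ _

theorem absolutelyContinuousOnInterval_of_hasDerivWithinAt {F : Type*} [NormedAddCommGroup F]
    [NormedSpace ℝ F] {f f' : ℝ → F} {a b : ℝ} (hab : a ≤ b)
    (hf : ∀ x ∈ Set.Icc a b, HasDerivWithinAt f (f' x) (Set.Icc a b) x)
    (hf' : ContinuousOn f' (Set.Icc a b)) : AbsolutelyContinuousOnInterval f a b := by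
  obtain ⟨C, hC⟩ := isCompact_Icc.exists_bound_of_continuousOn hf'
  have h : LipschitzOnWith C.toNNReal f (Set.uIcc a b) := by
    rw [Set.uIcc_of_le hab]
    refine (convex_Icc a b).lipschitzOnWith_of_nnnorm_hasDerivWithin_le hf fun x hx => ?_
    exact NNReal.coe_le_coe.mp ((hC x hx).trans (Real.le_coe_toNNReal C))
  exact h.absolutelyContinuousOnInterval

namespace IsSolutionOn

variable {q : ℝ → ℝ} {a : ℝ} {u u₁ U U₁ : ℝ → ℂ}

theorem continuousOn_deriv (ha : 0 < a) (h : IsSolutionOn q a u u₁) :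
    ContinuousOn u₁ (Set.Icc (-a) a) := by
  have := h.ac.continuousOn
  rwa [Set.uIcc_of_le (by linarith)] at this

theorem absolutelyContinuous (ha : 0 < a) (h : IsSolutionOn q a u u₁) :
    AbsolutelyContinuousOnInterval u (-a) a :=
  absolutelyContinuousOnInterval_of_hasDerivWithinAt (by linarith) h.hasDeriv
    (h.continuousOn_deriv ha)

theorem continuousOn (h : IsSolutionOn q a u u₁) : ContinuousOn u (Set.Icc (-a) a) :=
  fun x hx => (h.hasDeriv x hx).continuousWithinAt

theorem hasDerivAt (h : IsSolutionOn q a u u₁) {x : ℝ} (hx : x ∈ Set.Ioo (-a) a) :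
    HasDerivAt u (u₁ x) x :=
  (h.hasDeriv x (Set.Ioo_subset_Icc_self hx)).hasDerivAt (Icc_mem_nhds hx.1 hx.2)

theorem ae_mem_uIcc_iff (ha : 0 < a) {p : ℝ → Prop} :
    (∀ᵐ x, x ∈ Set.uIcc (-a) a → p x) ↔ ∀ᵐ x ∂(volume.restrict (Set.Ioo (-a) a)), p x := by
  rw [Set.uIcc_of_le (by linarith), ← ae_restrict_iff' measurableSet_Icc,
    Measure.restrict_congr_set Ioo_ae_eq_Icc]

/-- The Wronskian of two solutions is constant: it is absolutely continuous and its derivative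
vanishes almost everywhere. This needs no regularity of `q`. -/
theorem wronskian_const (ha : 0 < a) (h : IsSolutionOn q a u u₁) (H : IsSolutionOn q a U U₁)
    {x : ℝ} (hx : x ∈ Set.Icc (-a) a) :
    u x * U₁ x - u₁ x * U x = u 0 * U₁ 0 - u₁ 0 * U 0 := by
  have hac : AbsolutelyContinuousOnInterval (fun x => u x * U₁ x - u₁ x * U x) (-a) a :=
    ((h.absolutelyContinuous ha).fun_smul H.ac).fun_sub
      (h.ac.fun_smul (H.absolutelyContinuous ha))
  obtain ⟨C, hC⟩ := hac.const_of_ae_hasDerivAt_zero (by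
    rw [ae_mem_uIcc_iff ha]
    filter_upwards [h.hasDeriv₂, H.hasDeriv₂, ae_restrict_mem measurableSet_Ioo] with x h2 H2 hx
    refine (((h.hasDerivAt hx).fun_mul H2).fun_sub
      (h2.fun_mul (H.hasDerivAt hx))).congr_deriv ?_
    ring)
  rw [Set.uIcc_of_le (by linarith)] at hC
  exact (hC x hx).trans (hC 0 ⟨by linarith, ha.le⟩).symm

/-- The energy identity: `Re (ū u')` is absolutely continuous with derivative `|u'|² + q |u|²` and
vanishes at both ends, so for `q ≥ 0` the derivative `u'` vanishes. -/
theorem eq_zero_of_nonneg (ha : 0 < a) (h : IsSolutionOn q a u u₁) (hq : ∀ x, 0 ≤ q x)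
    (hl : u (-a) = 0) (hr : u a = 0) {x : ℝ} (hx : x ∈ Set.Ioo (-a) a) : u x = 0 := by
  have hle : -a ≤ a := by linarith
  have hre : LipschitzWith 1 Complex.re := LipschitzWith.of_dist_le_mul fun z w => by
    simpa [dist_eq_norm, ← Complex.sub_re] using Complex.abs_re_le_norm (z - w)
  have him : LipschitzWith 1 Complex.im := LipschitzWith.of_dist_le_mul fun z w => by
    simpa [dist_eq_norm, ← Complex.sub_im] using Complex.abs_im_le_norm (z - w)
  have hac := h.absolutelyContinuous ha
  set g : ℝ → ℝ := fun x => (u x).re * (u₁ x).re + (u x).im * (u₁ x).im with hg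
  have hgac : AbsolutelyContinuousOnInterval g (-a) a :=
    ((hre.comp_absolutelyContinuousOnInterval hac).fun_mul
      (hre.comp_absolutelyContinuousOnInterval h.ac)).fun_add
    ((him.comp_absolutelyContinuousOnInterval hac).fun_mul
      (him.comp_absolutelyContinuousOnInterval h.ac))
  have hder : ∀ᵐ x ∂(volume.restrict (Set.Ioo (-a) a)),
      deriv g x = ‖u₁ x‖ ^ 2 + q x * ‖u x‖ ^ 2 := by
    filter_upwards [h.hasDeriv₂, ae_restrict_mem measurableSet_Ioo] with x h2 hx
    have h1 := h.hasDerivAt hx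
    have r1 := Complex.reCLM.hasFDerivAt.comp_hasDerivAt x h1
    have i1 := Complex.imCLM.hasFDerivAt.comp_hasDerivAt x h1
    have r2 := Complex.reCLM.hasFDerivAt.comp_hasDerivAt x h2
    have i2 := Complex.imCLM.hasFDerivAt.comp_hasDerivAt x h2
    refine ((r1.fun_mul r2).fun_add (i1.fun_mul i2)).deriv.trans ?_
    simp only [Function.comp, Complex.reCLM_apply, Complex.imCLM_apply, Complex.re_ofReal_mul,
      Complex.im_ofReal_mul, Complex.sq_norm, Complex.normSq_apply]
    ring
  have hint : ∫ x in (-a)..a, deriv g x = 0 := by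
    rw [hgac.integral_deriv_eq_sub]
    simp [hg, hl, hr]
  rw [intervalIntegral.integral_of_le hle, ← Measure.restrict_congr_set Ioo_ae_eq_Ioc,
    integral_eq_zero_iff_of_nonneg_ae] at hint
  rotate_left
  · filter_upwards [hder] with x hx
    rw [hx, Pi.zero_apply]
    have := hq x
    positivity
  · exact (intervalIntegrable_iff_integrableOn_Ioo_of_le hle).1 hgac.intervalIntegrable_deriv
  have hu₁ : Set.EqOn u₁ (fun _ => 0) (Set.Ioo (-a) a) := by
    refine Measure.eqOn_open_of_ae_eq (μ := volume) ?_ isOpen_Ioo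
      ((h.continuousOn_deriv ha).mono Set.Ioo_subset_Icc_self) continuousOn_const
    filter_upwards [hder, hint] with x h1 h2
    rw [h2, Pi.zero_apply] at h1
    have h3 : 0 ≤ q x * ‖u x‖ ^ 2 := mul_nonneg (hq x) (by positivity)
    have h4 : ‖u₁ x‖ ^ 2 = 0 := le_antisymm (by linarith) (by positivity)
    simpa using h4
  -- At the left endpoint `u₁ = 0` holds by continuity.
  have hc := constant_of_has_deriv_right_zero (f := u) (a := -a) (b := a) h.continuousOn
    (fun y hy => by
      rcases eq_or_lt_of_le hy.1 with h1 | h1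
      · have h2 : u₁ y = 0 := by
          have h5 : Set.EqOn u₁ (fun _ => 0) (closure (Set.Ioo (-a) a)) := by
            refine hu₁.of_subset_closure ?_ continuousOn_const subset_closure subset_rfl
            rw [closure_Ioo (by linarith)]
            exact h.continuousOn_deriv ha
          rw [closure_Ioo (by linarith)] at h5
          exact h5 ⟨hy.1, hy.2.le⟩
        have h3 := h.hasDeriv y ⟨hy.1, hy.2.le⟩
        rw [h2] at h3
        exact h3.mono_of_mem_nhdsWithin (by
          rw [← h1]; exact Icc_mem_nhdsGE (by linarith))
      · have h3 := h.hasDerivAt ⟨h1, hy.2⟩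
        rw [hu₁ ⟨h1, hy.2⟩] at h3
        exact h3.hasDerivWithinAt)
  rw [hc x (Set.Ioo_subset_Icc_self hx), hl]

/-- A solution that vanishes almost everywhere vanishes together with its derivative. -/
theorem eq_zero_of_ae_eq_zero (h : IsSolutionOn q a u u₁)
    (h0 : ∀ᵐ x ∂(volume.restrict (Set.Ioo (-a) a)), u x = 0) {x : ℝ} (hx : x ∈ Set.Ioo (-a) a) :
    u x = 0 ∧ u₁ x = 0 := by
  have hu : Set.EqOn u (fun _ => 0) (Set.Ioo (-a) a) :=
    Measure.eqOn_open_of_ae_eq h0 isOpen_Ioo (h.continuousOn.mono Set.Ioo_subset_Icc_self)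
      continuousOn_const
  refine ⟨hu hx, (h.hasDerivAt hx).unique ((hasDerivAt_const x (0 : ℂ)).congr_of_eventuallyEq
    (hu.eventuallyEq_of_mem (isOpen_Ioo.mem_nhds hx)))⟩

theorem memLp (h : IsSolutionOn q a u u₁) :
    MemLp u 2 (volume.restrict (Set.Ioo (-a) a)) := by
  obtain ⟨C, hC⟩ := isCompact_Icc.exists_bound_of_continuousOn h.continuousOn
  refine MemLp.of_bound ((h.continuousOn.mono Set.Ioo_subset_Icc_self).aestronglyMeasurable
    measurableSet_Ioo) C ?_
  filter_upwards [ae_restrict_mem measurableSet_Ioo] with x hx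
  exact hC x (Set.Ioo_subset_Icc_self hx)

end IsSolutionOn

/-! ### Eigenfunctions as solutions of the differential equation -/

theorem mem_eigenspace_dirichletSchrodinger_iff_mem_graph {v : ℝ → ℝ} {L : ℝ} {μ : ℂ}
    {f : L2Interval L} :
    f ∈ (dirichletSchrodinger v L).eigenspace μ ↔ (f, μ • f) ∈ dirichletGraph v L := by
  rw [← dirichletSchrodinger_graph]
  rfl

/-- An eigenvector for a real eigenvalue `E` has a representative that solves `u'' = (v - E) u` and
vanishes at `±L/2`. -/
theorem exists_isSolutionOn_of_mem_eigenspace {v : ℝ → ℝ} {L E : ℝ} {f : L2Interval L}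
    (hf : f ∈ (dirichletSchrodinger v L).eigenspace (E : ℂ)) :
    ∃ u u₁ : ℝ → ℂ, IsSolutionOn (fun x => v x - E) (L / 2) u u₁ ∧ u (-(L / 2)) = 0 ∧
      u (L / 2) = 0 ∧ ∀ᵐ x ∂(volume.restrict (Set.Ioo (-(L / 2)) (L / 2))), f x = u x := by
  rw [mem_eigenspace_dirichletSchrodinger_iff_mem_graph] at hf
  obtain ⟨u, u₁, w, h, h1, h2⟩ := hf
  refine ⟨u, u₁, ⟨h.hasDeriv, h.ac, ?_⟩, h.left_eq_zero, h.right_eq_zero, h1⟩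
  filter_upwards [h.hasDeriv₂, h1, h2, Lp.coeFn_smul (E : ℂ) f] with x a1 a2 a3 a4
  convert a1 using 1
  simp only [a4, Pi.smul_apply, smul_eq_mul, a2] at a3
  push_cast
  linear_combination -a3

/-- Conversely, for a bounded measurable potential, a solution of `u'' = (v - E) u` that vanishes at
`±L/2` represents an element of the eigenspace. -/
theorem IsSolutionOn.toLp_mem_eigenspace {v : ℝ → ℝ} {L E M : ℝ}
    (hv : Measurable v) (hM : ∀ x, |v x| ≤ M) {u u₁ : ℝ → ℂ}
    (h : IsSolutionOn (fun x => v x - E) (L / 2) u u₁) (hl : u (-(L / 2)) = 0)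
    (hr : u (L / 2) = 0) :
    (h.memLp).toLp u ∈ (dirichletSchrodinger v L).eigenspace (E : ℂ) := by
  rw [mem_eigenspace_dirichletSchrodinger_iff_mem_graph]
  have hu := h.memLp
  have hw : MemLp (fun x => ((v x - E : ℝ) : ℂ) * u x) 2
      (volume.restrict (Set.Ioo (-(L / 2)) (L / 2))) := by
    refine MemLp.of_le_mul (c := M + |E|) hu ?_ (.of_forall fun x => ?_)
    · exact (Complex.measurable_ofReal.comp
        (hv.sub_const E)).aestronglyMeasurable.mul hu.aestronglyMeasurable
    · rw [norm_mul, Complex.norm_real, Real.norm_eq_abs]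
      have h1 := abs_sub (v x) E
      have h2 := hM x
      gcongr
      linarith
  refine ⟨u, u₁, hw.toLp _, ⟨h.hasDeriv, h.ac, ?_, hl, hr⟩, hu.coeFn_toLp, ?_⟩
  · filter_upwards [h.hasDeriv₂, hw.coeFn_toLp] with x h1 h2
    rwa [h2]
  · filter_upwards [hu.coeFn_toLp, hw.coeFn_toLp, Lp.coeFn_smul (E : ℂ) (hu.toLp u)]
      with x h1 h2 h3
    rw [h2, h3, Pi.smul_apply, h1, smul_eq_mul]
    push_cast
    ring

/-! ### Explicit solutions for the step potential -/

/-- The point of `[-b, b]` nearest to `x` (for `0 ≤ b`). -/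
def clampTo (b x : ℝ) : ℝ := max (-b) (min x b)

theorem clampTo_of_mem {b x : ℝ} (h₁ : -b ≤ x) (h₂ : x ≤ b) : clampTo b x = x := by
  simp [clampTo, h₁, h₂]

theorem clampTo_of_ge {b x : ℝ} (hb : 0 ≤ b) (h : b ≤ x) : clampTo b x = b := by
  rw [clampTo, min_eq_right h, max_eq_right (by linarith)]

theorem clampTo_of_le {b x : ℝ} (h : x ≤ -b) : clampTo b x = -b :=
  max_eq_left ((min_le_left _ _).trans h)

theorem continuous_clampTo (b : ℝ) : Continuous (clampTo b) := by
  unfold clampTo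
  fun_prop

/-- The continuation of `p`, given with its derivative `p₁` on the barrier `[-b, b]`, to both sides by
the solution of `u'' = -k² u` that matches `p` and `p₁` at `±b`. With `r` the point of `[-b, b]`
nearest to `x`, it is `p(r) cos (k (x - r)) + p₁(r) sin (k (x - r)) / k`, which is `p x` inside. -/
def stepExtension (k b : ℝ) (p p₁ : ℝ → ℝ) (x : ℝ) : ℝ :=
  p (clampTo b x) * Real.cos (k * (x - clampTo b x)) +
    p₁ (clampTo b x) * (Real.sin (k * (x - clampTo b x)) / k)

/-- The derivative of `stepExtension k b p p₁`. -/
def stepExtensionDeriv (k b : ℝ) (p p₁ : ℝ → ℝ) (x : ℝ) : ℝ :=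
  p₁ (clampTo b x) * Real.cos (k * (x - clampTo b x)) -
    p (clampTo b x) * (k * Real.sin (k * (x - clampTo b x)))

section

variable {k b v₀ : ℝ} {p p₁ : ℝ → ℝ}

theorem hasDerivAt_oscillation (hk : k ≠ 0) (A B c x : ℝ) :
    HasDerivAt (fun x => A * Real.cos (k * (x - c)) + B * (Real.sin (k * (x - c)) / k))
      (B * Real.cos (k * (x - c)) - A * (k * Real.sin (k * (x - c)))) x := by
  have h : HasDerivAt (fun x => k * (x - c)) k x := by
    simpa using ((hasDerivAt_id x).sub_const c).const_mul k
  refine ((h.cos.const_mul A).fun_add ((h.sin.div_const k).const_mul B)).congr_deriv ?_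
  field_simp
  ring

theorem hasDerivAt_oscillation_deriv (hk : k ≠ 0) (A B c x : ℝ) :
    HasDerivAt (fun x => B * Real.cos (k * (x - c)) - A * (k * Real.sin (k * (x - c))))
      (-k ^ 2 * (A * Real.cos (k * (x - c)) + B * (Real.sin (k * (x - c)) / k))) x := by
  have h : HasDerivAt (fun x => k * (x - c)) k x := by
    simpa using ((hasDerivAt_id x).sub_const c).const_mul k
  refine ((h.cos.const_mul B).fun_sub ((h.sin.const_mul k).const_mul A)).congr_deriv ?_
  field_simp
  ring

theorem stepExtension_hasDerivAt_of_ne (hk : k ≠ 0) (hb : 0 < b)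
    (hp : ∀ x, HasDerivAt p (p₁ x) x) (hp₁ : ∀ x, HasDerivAt p₁ ((v₀ - k ^ 2) * p x) x)
    {x : ℝ} (h₁ : x ≠ -b) (h₂ : x ≠ b) :
    HasDerivAt (stepExtension k b p p₁) (stepExtensionDeriv k b p p₁ x) x ∧
    HasDerivAt (stepExtensionDeriv k b p p₁)
      ((stepPotential v₀ b x - k ^ 2) * stepExtension k b p p₁ x) x := by
  have outside : ∀ c, clampTo b x = c → (∀ᶠ y in nhds x, clampTo b y = c) →
      stepPotential v₀ b x = 0 →
      HasDerivAt (stepExtension k b p p₁) (stepExtensionDeriv k b p p₁ x) x ∧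
      HasDerivAt (stepExtensionDeriv k b p p₁)
        ((stepPotential v₀ b x - k ^ 2) * stepExtension k b p p₁ x) x := by
    intro c hc hev hv
    constructor
    · have := hasDerivAt_oscillation hk (p c) (p₁ c) c x
      rw [stepExtensionDeriv, hc]
      refine this.congr_of_eventuallyEq ?_
      filter_upwards [hev] with y hy
      rw [stepExtension, hy]
    · have := hasDerivAt_oscillation_deriv hk (p c) (p₁ c) c x
      rw [stepExtension, hc, hv, zero_sub]
      refine this.congr_of_eventuallyEq ?_
      filter_upwards [hev] with y hy
      rw [stepExtensionDeriv, hy]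
  rcases lt_or_gt_of_ne h₁ with h | h
  · refine outside (-b) (clampTo_of_le h.le) ?_ ?_
    · filter_upwards [Iio_mem_nhds h] with y hy using clampTo_of_le (le_of_lt hy)
    · exact indicator_of_notMem (fun hx : x ∈ Icc (-b) b => absurd hx.1 (not_le.2 h)) _
  rcases lt_or_gt_of_ne h₂ with h' | h'
  · have hev : ∀ᶠ y in nhds x, clampTo b y = y := by
      filter_upwards [Ioo_mem_nhds h h'] with y hy using clampTo_of_mem hy.1.le hy.2.le
    have hv : stepPotential v₀ b x = v₀ :=
      indicator_of_mem (show x ∈ Icc (-b) b from ⟨h.le, h'.le⟩) _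
    constructor
    · refine HasDerivAt.congr_of_eventuallyEq (f := p) ((hp x).congr_deriv ?_) ?_
      · simp [stepExtensionDeriv, hev.self_of_nhds]
      · filter_upwards [hev] with y hy
        simp [stepExtension, hy]
    · refine HasDerivAt.congr_of_eventuallyEq (f := p₁) ((hp₁ x).congr_deriv ?_) ?_
      · simp [stepExtension, hev.self_of_nhds, hv]
      · filter_upwards [hev] with y hy
        simp [stepExtensionDeriv, hy]
  · refine outside b (clampTo_of_ge hb.le h'.le) ?_ ?_
    · filter_upwards [Ioi_mem_nhds h'] with y hy using clampTo_of_ge hb.le (le_of_lt hy)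
    · exact indicator_of_notMem (fun hx : x ∈ Icc (-b) b => absurd hx.2 (not_le.2 h')) _

/-- If the candidate `f'` is continuous, a countable set of points at which the derivative of the
continuous function `f` is not known does no harm, since `f` is the integral of `f'`. -/
theorem hasDerivAt_of_hasDerivAt_off_countable {f f' : ℝ → ℝ} {s : Set ℝ} (hs : s.Countable)
    (hf : Continuous f) (hf' : Continuous f') (h : ∀ x ∉ s, HasDerivAt f (f' x) x) (x : ℝ) :
    HasDerivAt f (f' x) x := by
  have key : f = fun y => f 0 + ∫ t in (0 : ℝ)..y, f' t := by
    funext y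
    rw [integral_eq_of_hasDerivAt_off_countable f f' hs hf.continuousOn
      (fun t ht => h t ht.2) (hf'.intervalIntegrable _ _)]
    ring
  rw [key]
  exact (hf'.integral_hasStrictDerivAt 0 x).hasDerivAt.const_add _

/-- If `p'' = (v₀ - k²) p`, then the continuation of `p` solves `u'' = (v - k²) u` for the step
potential `v`. -/
theorem isSolutionOn_stepExtension (hk : k ≠ 0) (hb : 0 < b)
    (hp : ∀ x, HasDerivAt p (p₁ x) x) (hp₁ : ∀ x, HasDerivAt p₁ ((v₀ - k ^ 2) * p x) x)
    (a : ℝ) :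
    IsSolutionOn (fun x => stepPotential v₀ b x - k ^ 2) a
      (fun x => (stepExtension k b p p₁ x : ℂ)) (fun x => (stepExtensionDeriv k b p p₁ x : ℂ)) := by
  have cp : Continuous p := continuous_iff_continuousAt.2 fun x => (hp x).continuousAt
  have cp₁ : Continuous p₁ := continuous_iff_continuousAt.2 fun x => (hp₁ x).continuousAt
  have cr := continuous_clampTo b
  have cE : Continuous (stepExtension k b p p₁) := by
    unfold stepExtension
    fun_prop
  have cD : Continuous (stepExtensionDeriv k b p p₁) := by
    unfold stepExtensionDeriv
    fun_prop
  have hs : ({-b, b} : Set ℝ).Countable := (Set.toFinite _).countable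
  have hE := hasDerivAt_of_hasDerivAt_off_countable hs cE cD fun x hx => by
    simp only [mem_insert_iff, mem_singleton_iff, not_or] at hx
    exact (stepExtension_hasDerivAt_of_ne hk hb hp hp₁ hx.1 hx.2).1
  have hD : ∀ x ∉ ({-b, b} : Set ℝ), HasDerivAt (stepExtensionDeriv k b p p₁)
      ((stepPotential v₀ b x - k ^ 2) * stepExtension k b p p₁ x) x := fun x hx => by
    simp only [mem_insert_iff, mem_singleton_iff, not_or] at hx
    exact (stepExtension_hasDerivAt_of_ne hk hb hp hp₁ hx.1 hx.2).2
  have hint : ∀ c d, IntervalIntegrable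
      (fun x => (stepPotential v₀ b x - k ^ 2) * stepExtension k b p p₁ x) volume c d := by
    intro c d
    refine IntervalIntegrable.mul_continuousOn ?_ cE.continuousOn
    refine IntervalIntegrable.sub ?_ intervalIntegrable_const
    rw [intervalIntegrable_iff]
    exact IntegrableOn.indicator (by simp) measurableSet_Icc
  refine ⟨fun x _ => (hE x).ofReal_comp.hasDerivWithinAt, ?_, ?_⟩
  · have h1 := (hint (-a) a).absolutelyContinuousOnInterval_intervalIntegral (c := -a) (by simp)
    have h2 : AbsolutelyContinuousOnInterval (stepExtensionDeriv k b p p₁) (-a) a := by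
      have h3 := AbsolutelyContinuousOnInterval.fun_add
        (LipschitzOnWith.absolutelyContinuousOnInterval
          (LipschitzWith.const (stepExtensionDeriv k b p p₁ (-a))).lipschitzOnWith) h1
      have h4 : stepExtensionDeriv k b p p₁ = fun x => stepExtensionDeriv k b p p₁ (-a) +
          ∫ t in (-a)..x, (stepPotential v₀ b t - k ^ 2) * stepExtension k b p p₁ t := by
        funext x
        rw [integral_eq_of_hasDerivAt_off_countable _ _ hs cD.continuousOn
          (fun t ht => hD t ht.2) (hint _ _)]
        ring
      rw [h4]
      exact h3
    exact LipschitzWith.comp_absolutelyContinuousOnInterval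
      Complex.isometry_ofReal.lipschitz h2
  · refine ae_restrict_of_ae ?_
    filter_upwards [hs.ae_notMem volume] with x hx
    exact_mod_cast (hD x hx).ofReal_comp

end

/-- Every solution is determined by its value and its derivative at `0`, as the Wronskian of the
fundamental system `U`, `V` is `1`. -/
theorem IsSolutionOn.eq_combination {q : ℝ → ℝ} {a : ℝ} {u u₁ U U₁ V V₁ : ℝ → ℂ} (ha : 0 < a)
    (h : IsSolutionOn q a u u₁) (hU : IsSolutionOn q a U U₁) (hV : IsSolutionOn q a V V₁)
    (hU0 : U 0 = 1) (hU₁0 : U₁ 0 = 0) (hV0 : V 0 = 0) (hV₁0 : V₁ 0 = 1)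
    {x : ℝ} (hx : x ∈ Icc (-a) a) : u x = u 0 * U x + u₁ 0 * V x := by
  have h1 := h.wronskian_const ha hU hx
  have h2 := h.wronskian_const ha hV hx
  have h3 := hU.wronskian_const ha hV hx
  rw [hU0, hU₁0] at h1
  rw [hV0, hV₁0] at h2
  rw [hU0, hU₁0, hV0, hV₁0] at h3
  linear_combination (-u x) * h3 + U x * h2 - V x * h1

/-- The even solution of `u'' = (v₀ 1_{[-b, b]} - k²) u` with `u 0 = 1`, where `κ² = v₀ - k²`. -/
def evenSolution (k κ b : ℝ) : ℝ → ℝ :=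
  stepExtension k b (fun x => Real.cosh (κ * x)) (fun x => κ * Real.sinh (κ * x))

/-- The derivative of `evenSolution k κ b`. -/
def evenSolutionDeriv (k κ b : ℝ) : ℝ → ℝ :=
  stepExtensionDeriv k b (fun x => Real.cosh (κ * x)) (fun x => κ * Real.sinh (κ * x))

/-- The odd solution of `u'' = (v₀ 1_{[-b, b]} - k²) u` with `u' 0 = 1`, where `κ² = v₀ - k²`. -/
def oddSolution (k κ b : ℝ) : ℝ → ℝ :=
  stepExtension k b (fun x => Real.sinh (κ * x) / κ) (fun x => Real.cosh (κ * x))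

/-- The derivative of `oddSolution k κ b`. -/
def oddSolutionDeriv (k κ b : ℝ) : ℝ → ℝ :=
  stepExtensionDeriv k b (fun x => Real.sinh (κ * x) / κ) (fun x => Real.cosh (κ * x))

section

variable {k κ b v₀ a : ℝ}

theorem isSolutionOn_evenSolution (hk : k ≠ 0) (hb : 0 < b) (hκv : κ ^ 2 = v₀ - k ^ 2)
    (a : ℝ) :
    IsSolutionOn (fun x => stepPotential v₀ b x - k ^ 2) a
      (fun x => (evenSolution k κ b x : ℂ)) (fun x => (evenSolutionDeriv k κ b x : ℂ)) := by
  have h : ∀ x, HasDerivAt (fun x => κ * x) κ x := fun x => by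
    simpa using (hasDerivAt_id x).const_mul κ
  refine isSolutionOn_stepExtension hk hb (fun x => ?_) (fun x => ?_) a
  · exact (h x).cosh.congr_deriv (by ring)
  · exact ((h x).sinh.const_mul κ).congr_deriv (by rw [← hκv]; ring)

theorem isSolutionOn_oddSolution (hk : k ≠ 0) (hκ : κ ≠ 0) (hb : 0 < b)
    (hκv : κ ^ 2 = v₀ - k ^ 2) (a : ℝ) :
    IsSolutionOn (fun x => stepPotential v₀ b x - k ^ 2) a
      (fun x => (oddSolution k κ b x : ℂ)) (fun x => (oddSolutionDeriv k κ b x : ℂ)) := by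
  have h : ∀ x, HasDerivAt (fun x => κ * x) κ x := fun x => by
    simpa using (hasDerivAt_id x).const_mul κ
  refine isSolutionOn_stepExtension hk hb (fun x => ?_) (fun x => ?_) a
  · exact ((h x).sinh.div_const κ).congr_deriv (by field_simp)
  · exact (h x).cosh.congr_deriv (by rw [← hκv]; field_simp)

theorem evenSolution_right (hb : 0 ≤ b) (ha : b ≤ a) :
    evenSolution k κ b a = Real.cosh (κ * b) * Real.cos (k * (a - b)) +
      κ * Real.sinh (κ * b) * (Real.sin (k * (a - b)) / k) := by
  simp [evenSolution, stepExtension, clampTo_of_ge hb ha]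

theorem evenSolution_left (hb : 0 ≤ b) (ha : b ≤ a) :
    evenSolution k κ b (-a) = evenSolution k κ b a := by
  rw [evenSolution_right hb ha, evenSolution, stepExtension,
    clampTo_of_le (by linarith : -a ≤ -b), show k * (-a - -b) = -(k * (a - b)) by ring]
  simp only [mul_neg, Real.cosh_neg, Real.sinh_neg, Real.cos_neg, Real.sin_neg]
  ring

theorem oddSolution_right (hb : 0 ≤ b) (ha : b ≤ a) :
    oddSolution k κ b a = Real.sinh (κ * b) / κ * Real.cos (k * (a - b)) +
      Real.cosh (κ * b) * (Real.sin (k * (a - b)) / k) := by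
  simp [oddSolution, stepExtension, clampTo_of_ge hb ha]

theorem oddSolution_left (hb : 0 ≤ b) (ha : b ≤ a) :
    oddSolution k κ b (-a) = -oddSolution k κ b a := by
  rw [oddSolution_right hb ha, oddSolution, stepExtension,
    clampTo_of_le (by linarith : -a ≤ -b), show k * (-a - -b) = -(k * (a - b)) by ring]
  simp only [mul_neg, Real.cosh_neg, Real.sinh_neg, Real.cos_neg, Real.sin_neg]
  ring

theorem clampTo_zero (hb : 0 ≤ b) : clampTo b 0 = 0 := clampTo_of_mem (by linarith) hb

theorem evenSolution_zero (hb : 0 ≤ b) : evenSolution k κ b 0 = 1 := by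
  simp [evenSolution, stepExtension, clampTo_zero hb]

theorem evenSolutionDeriv_zero (hb : 0 ≤ b) : evenSolutionDeriv k κ b 0 = 0 := by
  simp [evenSolutionDeriv, stepExtensionDeriv, clampTo_zero hb]

theorem oddSolution_zero (hb : 0 ≤ b) : oddSolution k κ b 0 = 0 := by
  simp [oddSolution, stepExtension, clampTo_zero hb]

theorem oddSolutionDeriv_zero (hb : 0 ≤ b) : oddSolutionDeriv k κ b 0 = 1 := by
  simp [oddSolutionDeriv, stepExtensionDeriv, clampTo_zero hb]

/-! ### Eigenspaces for the step potential -/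

variable {L : ℝ}

/-- An eigenvector for `k²` is a combination of the even and the odd solution. Adding and subtracting
the boundary conditions at `±L/2` shows that each of the two parts satisfies them separately. -/
theorem exists_combination_of_mem_eigenspace (hk : k ≠ 0) (hκ : κ ≠ 0) (hb : 0 < b)
    (hκv : κ ^ 2 = v₀ - k ^ 2) (hL : b ≤ L / 2) {f : L2Interval L}
    (hf : f ∈ (dirichletSchrodinger (stepPotential v₀ b) L).eigenspace ((k ^ 2 : ℝ) : ℂ)) :
    ∃ P Q : ℂ, P * evenSolution k κ b (L / 2) = 0 ∧ Q * oddSolution k κ b (L / 2) = 0 ∧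
      ∀ᵐ x ∂(volume.restrict (Ioo (-(L / 2)) (L / 2))),
        f x = P * evenSolution k κ b x + Q * oddSolution k κ b x := by
  obtain ⟨u, u₁, h, hl, hr, hfu⟩ := exists_isSolutionOn_of_mem_eigenspace hf
  have ha : 0 < L / 2 := by linarith
  have key : ∀ x ∈ Icc (-(L / 2)) (L / 2),
      u x = u 0 * evenSolution k κ b x + u₁ 0 * oddSolution k κ b x := fun x hx =>
    h.eq_combination ha (isSolutionOn_evenSolution hk hb hκv (L / 2))
      (isSolutionOn_oddSolution hk hκ hb hκv (L / 2)) (by simp [evenSolution_zero hb.le])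
      (by simp [evenSolutionDeriv_zero hb.le]) (by simp [oddSolution_zero hb.le])
      (by simp [oddSolutionDeriv_zero hb.le]) hx
  have e1 := key (L / 2) ⟨by linarith, le_rfl⟩
  have e2 := key (-(L / 2)) ⟨le_rfl, by linarith⟩
  rw [hr] at e1
  rw [hl, evenSolution_left hb.le hL, oddSolution_left hb.le hL] at e2
  push_cast at e2
  refine ⟨u 0, u₁ 0, by linear_combination (-1 / 2 : ℂ) * (e1 + e2),
    by linear_combination (-1 / 2 : ℂ) * (e1 - e2), ?_⟩
  filter_upwards [hfu, ae_restrict_mem measurableSet_Ioo] with x h1 h2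
  rw [h1, key x (Ioo_subset_Icc_self h2)]

theorem eigenspace_eq_bot_of_ne_zero (hk : k ≠ 0) (hκ : κ ≠ 0) (hb : 0 < b)
    (hκv : κ ^ 2 = v₀ - k ^ 2) (hL : b ≤ L / 2) (he : evenSolution k κ b (L / 2) ≠ 0)
    (ho : oddSolution k κ b (L / 2) ≠ 0) :
    (dirichletSchrodinger (stepPotential v₀ b) L).eigenspace ((k ^ 2 : ℝ) : ℂ) = ⊥ := by
  rw [eq_bot_iff]
  intro f hf
  obtain ⟨P, Q, hP, hQ, h⟩ := exists_combination_of_mem_eigenspace hk hκ hb hκv hL hf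
  have hP0 : P = 0 := by simpa [he] using hP
  have hQ0 : Q = 0 := by simpa [ho] using hQ
  rw [Submodule.mem_bot, Lp.eq_zero_iff_ae_eq_zero]
  filter_upwards [h] with x hx
  simp [hx, hP0, hQ0]

theorem measurable_stepPotential : Measurable (stepPotential v₀ b) :=
  measurable_const.indicator measurableSet_Icc

theorem stepPotential_nonneg (hv₀ : 0 ≤ v₀) (x : ℝ) : 0 ≤ stepPotential v₀ b x :=
  indicator_nonneg (fun _ _ => hv₀) x

theorem abs_stepPotential_le (x : ℝ) : |stepPotential v₀ b x| ≤ |v₀| := by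
  rw [stepPotential, indicator_apply]
  split_ifs <;> simp

theorem exists_eigenspace_eq_span (hk : k ≠ 0) (hκ : κ ≠ 0) (hb : 0 < b)
    (hκv : κ ^ 2 = v₀ - k ^ 2) (hL : b ≤ L / 2) (he : evenSolution k κ b (L / 2) = 0)
    (ho : oddSolution k κ b (L / 2) ≠ 0) :
    ∃ f : L2Interval L, f ≠ 0 ∧
      (dirichletSchrodinger (stepPotential v₀ b) L).eigenspace ((k ^ 2 : ℝ) : ℂ) =
        Submodule.span ℂ {f} := by
  have ha : 0 < L / 2 := by linarith
  have h := isSolutionOn_evenSolution hk hb hκv (L / 2)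
  refine ⟨h.memLp.toLp _, fun h0 => ?_, le_antisymm (fun g hg => ?_) ?_⟩
  · have := (h.eq_zero_of_ae_eq_zero (h.memLp.coeFn_toLp.symm.trans
      (Lp.eq_zero_iff_ae_eq_zero.1 h0))
      (x := 0) ⟨by linarith, ha⟩).1
    simp [evenSolution_zero hb.le] at this
  · obtain ⟨P, Q, hP, hQ, hg⟩ := exists_combination_of_mem_eigenspace hk hκ hb hκv hL hg
    have hQ0 : Q = 0 := by simpa [ho] using hQ
    refine Submodule.mem_span_singleton.2 ⟨P, ?_⟩
    refine Lp.ext ?_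
    filter_upwards [hg, h.memLp.coeFn_toLp, Lp.coeFn_smul P (h.memLp.toLp _)] with x h1 h2 h3
    rw [h3, h1, Pi.smul_apply, h2, hQ0, smul_eq_mul, zero_mul, add_zero]
  · rw [Submodule.span_singleton_le_iff_mem]
    exact h.toLp_mem_eigenspace measurable_stepPotential abs_stepPotential_le
      (by simp [evenSolution_left hb.le hL, he]) (by simp [he])

theorem exists_mem_eigenspace_of_oddSolution_eq_zero (hk : k ≠ 0) (hκ : κ ≠ 0) (hb : 0 < b)
    (hκv : κ ^ 2 = v₀ - k ^ 2) (hL : b ≤ L / 2) (ho : oddSolution k κ b (L / 2) = 0) :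
    ∃ f ∈ (dirichletSchrodinger (stepPotential v₀ b) L).eigenspace ((k ^ 2 : ℝ) : ℂ), f ≠ 0 := by
  have ha : 0 < L / 2 := by linarith
  have h := isSolutionOn_oddSolution hk hκ hb hκv (L / 2)
  refine ⟨h.memLp.toLp _, ?_, fun h0 => ?_⟩
  · exact h.toLp_mem_eigenspace measurable_stepPotential abs_stepPotential_le
      (by simp [oddSolution_left hb.le hL, ho]) (by simp [ho])
  · have := (h.eq_zero_of_ae_eq_zero (h.memLp.coeFn_toLp.symm.trans
      (Lp.eq_zero_iff_ae_eq_zero.1 h0))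
      (x := 0) ⟨by linarith, ha⟩).2
    simp [oddSolutionDeriv_zero hb.le] at this

end

theorem eigenspace_eq_bot_of_nonpos {v : ℝ → ℝ} {L E : ℝ} (hL : 0 < L) (hv : ∀ x, 0 ≤ v x)
    (hE : E ≤ 0) : (dirichletSchrodinger v L).eigenspace (E : ℂ) = ⊥ := by
  rw [eq_bot_iff]
  intro f hf
  obtain ⟨u, u₁, h, hl, hr, hfu⟩ := exists_isSolutionOn_of_mem_eigenspace hf
  rw [Submodule.mem_bot, Lp.eq_zero_iff_ae_eq_zero]
  filter_upwards [hfu, ae_restrict_mem measurableSet_Ioo] with x h1 h2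
  rw [h1, h.eq_zero_of_nonneg (half_pos hL) (fun y => by linarith [hv y]) hl hr h2]
  rfl

/-! ### Counting eigenvalues -/

section

variable {E : Type*} [AddCommGroup E] [Module ℂ E] {T : E →ₗ.[ℂ] E} {E₀ E₁ : ℝ} {f₀ f₁ : E}

theorem LinearPMap.eq_zero_of_mem_eigenspace_of_ne {μ ν : ℂ} (h : μ ≠ ν) {f : E}
    (hμ : f ∈ T.eigenspace μ) (hν : f ∈ T.eigenspace ν) : f = 0 := by
  obtain ⟨h1, h2⟩ := (T.mem_eigenspace_iff μ f).1 hμ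
  obtain ⟨_, h4⟩ := (T.mem_eigenspace_iff ν f).1 hν
  have h5 : (μ - ν) • f = 0 := by rw [sub_smul, ← h2, ← h4, sub_self]
  exact (smul_eq_zero.1 h5).resolve_left (sub_ne_zero.2 h)

theorem mem_energiesAbove_zero_of_le {t : ℝ} (hf : f₀ ∈ T.eigenspace (E₀ : ℂ)) (hf0 : f₀ ≠ 0)
    (ht : E₀ ≤ t) : t ∈ energiesAbove T 0 := by
  have hle : T.eigenspace (E₀ : ℂ) ≤ ⨆ μ : Iic t, T.eigenspace ((μ : ℝ) : ℂ) :=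
    le_iSup (fun μ : Iic t => T.eigenspace ((μ : ℝ) : ℂ)) ⟨E₀, ht⟩
  rw [energiesAbove, mem_ofPred_eq, zero_add, Nat.cast_one, Cardinal.one_le_iff_ne_zero,
    Ne, Submodule.rank_eq_zero]
  intro h
  rw [h] at hle
  exact hf0 (by simpa using hle hf)

theorem mem_energiesAbove_one_of_le {t : ℝ} (hf : f₀ ∈ T.eigenspace (E₀ : ℂ)) (hf0 : f₀ ≠ 0)
    (hg : f₁ ∈ T.eigenspace (E₁ : ℂ)) (hg0 : f₁ ≠ 0) (hE : E₀ < E₁) (ht : E₁ ≤ t) :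
    t ∈ energiesAbove T 1 := by
  set R := ⨆ μ : Iic t, T.eigenspace ((μ : ℝ) : ℂ) with hR
  have h₀ : f₀ ∈ R := le_iSup (fun μ : Iic t => T.eigenspace ((μ : ℝ) : ℂ))
    ⟨E₀, hE.le.trans ht⟩ hf
  have h₁ : f₁ ∈ R := le_iSup (fun μ : Iic t => T.eigenspace ((μ : ℝ) : ℂ)) ⟨E₁, ht⟩ hg
  have hli : LinearIndependent ℂ ![(⟨f₀, h₀⟩ : R), ⟨f₁, h₁⟩] := by
    rw [LinearIndependent.pair_iff' (by simpa using hf0)]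
    intro c hc
    have hc' : c • f₀ = f₁ := congrArg Subtype.val hc
    refine hg0 (T.eq_zero_of_mem_eigenspace_of_ne (μ := (E₀ : ℂ)) (ν := (E₁ : ℂ)) ?_ ?_ hg)
    · exact_mod_cast hE.ne
    · exact hc' ▸ Submodule.smul_mem _ c hf
  have := hli.cardinal_lift_le_rank
  rw [energiesAbove, mem_ofPred_eq]
  simpa using this

theorem energiesAbove_zero_eq (hf : T.eigenspace (E₀ : ℂ) = Submodule.span ℂ {f₀}) (hf0 : f₀ ≠ 0)
    (hbot : ∀ x < E₀, T.eigenspace (x : ℂ) = ⊥) : energiesAbove T 0 = Ici E₀ := by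
  ext t
  refine ⟨fun h => ?_, mem_energiesAbove_zero_of_le
    (hf ▸ Submodule.mem_span_singleton_self f₀) hf0⟩
  by_contra ht
  have h0 : (⨆ μ : Iic t, T.eigenspace ((μ : ℝ) : ℂ)) = ⊥ :=
    iSup_eq_bot.2 fun μ => hbot _ (lt_of_le_of_lt μ.2 (not_le.1 ht))
  rw [energiesAbove, mem_ofPred_eq, h0] at h
  simp at h

theorem energiesAbove_one_eq (hf : T.eigenspace (E₀ : ℂ) = Submodule.span ℂ {f₀}) (hf0 : f₀ ≠ 0)
    (hg : f₁ ∈ T.eigenspace (E₁ : ℂ)) (hg0 : f₁ ≠ 0) (hE : E₀ < E₁)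
    (hbot : ∀ x < E₁, x ≠ E₀ → T.eigenspace (x : ℂ) = ⊥) : energiesAbove T 1 = Ici E₁ := by
  ext t
  refine ⟨fun h => ?_, mem_energiesAbove_one_of_le
    (hf ▸ Submodule.mem_span_singleton_self f₀) hf0 hg hg0 hE⟩
  by_contra ht
  have h0 : (⨆ μ : Iic t, T.eigenspace ((μ : ℝ) : ℂ)) ≤ Submodule.span ℂ {f₀} := by
    refine iSup_le fun μ => ?_
    by_cases hμ : (μ : ℝ) = E₀
    · rw [hμ, hf]
    · rw [hbot _ (lt_of_le_of_lt μ.2 (not_le.1 ht)) hμ]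
      exact bot_le
  rw [energiesAbove, mem_ofPred_eq] at h
  have h1 := (h.trans (Submodule.rank_mono h0)).trans (rank_span_le _)
  rw [Cardinal.mk_singleton] at h1
  exact absurd h1 (by norm_num)

end

/-! ### The phase condition -/

/-- The left side is a positive multiple of `sin (θ + arctan (k / m))`, whose argument lies in
`(0, 3π/2)`. -/
theorem matching_iff {k m θ : ℝ} (hk : 0 < k) (hm : 0 < m) (h0 : 0 < θ) (hπ : θ < Real.pi) :
    k * Real.cos θ + m * Real.sin θ = 0 ↔ θ + Real.arctan (k / m) = Real.pi := by
  have hc := Real.cos_arctan_pos (k / m)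
  have hs : Real.sin (Real.arctan (k / m)) = k / m * Real.cos (Real.arctan (k / m)) := by
    rw [← Real.tan_mul_cos hc.ne', Real.tan_arctan]
  have h1 : Real.sin (θ + Real.arctan (k / m) - Real.pi) =
      -(Real.cos (Real.arctan (k / m)) / m) * (k * Real.cos θ + m * Real.sin θ) := by
    rw [Real.sin_sub_pi, Real.sin_add, hs]
    field_simp
    ring
  have h2 : 0 < Real.arctan (k / m) := Real.arctan_pos.2 (by positivity)
  have h3 := Real.arctan_lt_pi_div_two (k / m)
  have h4 := Real.sin_eq_zero_iff_of_lt_of_lt (x := θ + Real.arctan (k / m) - Real.pi)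
    (by linarith) (by linarith [Real.pi_pos])
  have h5 : -(Real.cos (Real.arctan (k / m)) / m) ≠ 0 := neg_ne_zero.2 (by positivity)
  rw [h1, mul_eq_zero, or_iff_right h5, sub_eq_zero] at h4
  exact h4

/-- The phase that a wave with wave number `k` and logarithmic derivative `m k` at one end of an
interval of length `ℓ` has at the other end; the wave vanishes there if the phase is a multiple
of `π`. -/
def phase (m : ℝ → ℝ) (ℓ k : ℝ) : ℝ := k * ℓ + Real.arctan (k / m k)

section

variable {m m' : ℝ → ℝ} {K ℓ : ℝ}

theorem phase_strictMonoOn (hℓ : 0 < ℓ) (hm : AntitoneOn m (Icc 0 K))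
    (hpos : ∀ k ∈ Icc 0 K, 0 < m k) : StrictMonoOn (phase m ℓ) (Icc 0 K) := by
  intro x hx y hy hxy
  refine add_lt_add_of_lt_of_le (mul_lt_mul_of_pos_right hxy hℓ)
    (Real.arctan_strictMono.monotone ?_)
  exact div_le_div₀ hy.1 hxy.le (hpos y hy) (hm hx hy hxy.le)

theorem phase_lt_phase {k : ℝ} (hk : 0 < k) (hm : 0 < m k) (h : m k < m' k) :
    phase m' ℓ k < phase m ℓ k :=
  add_lt_add_right (Real.arctan_strictMono (div_lt_div_of_pos_left hk hm h)) _

theorem exists_phase_eq_pi (hℓ : 0 < ℓ) (hK : Real.pi / ℓ ≤ K) (hcont : ContinuousOn m (Icc 0 K))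
    (hpos : ∀ k ∈ Icc 0 K, 0 < m k) : ∃ k ∈ Ioo 0 (Real.pi / ℓ), phase m ℓ k = Real.pi := by
  have hp : 0 < Real.pi / ℓ := div_pos Real.pi_pos hℓ
  have hsub : Icc 0 (Real.pi / ℓ) ⊆ Icc 0 K := Icc_subset_Icc_right hK
  have hc : ContinuousOn (phase m ℓ) (Icc 0 (Real.pi / ℓ)) := by
    refine (continuousOn_id.mul continuousOn_const).add (Real.continuous_arctan.comp_continuousOn ?_)
    exact continuousOn_id.div (hcont.mono hsub) fun k hk => (hpos k (hsub hk)).ne'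
  refine intermediate_value_Ioo hp.le hc ⟨?_, ?_⟩
  · simpa [phase] using Real.pi_pos
  · rw [phase, div_mul_cancel₀ _ hℓ.ne', lt_add_iff_pos_right, Real.arctan_pos]
    exact div_pos hp (hpos _ ⟨hp.le, hK⟩)

end

/-! ### Bounds for the gap between two phase conditions -/

theorem arctan_le_self {x : ℝ} (hx : 0 ≤ x) : Real.arctan x ≤ x := by
  have h := Real.le_tan (Real.arctan_nonneg.2 hx) (Real.arctan_lt_pi_div_two x)
  rwa [Real.tan_arctan] at h

theorem div_one_add_sq_le_arctan {x : ℝ} (hx : 0 ≤ x) : x / (1 + x ^ 2) ≤ Real.arctan x := by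
  have h1 : Real.sin (Real.arctan x) ≤ Real.arctan x := Real.sin_le (Real.arctan_nonneg.2 hx)
  rw [Real.sin_arctan] at h1
  refine le_trans ?_ h1
  refine div_le_div_of_nonneg_left hx (by positivity) ?_
  exact Real.sqrt_le_iff.2 ⟨by positivity, by nlinarith [sq_nonneg x]⟩

theorem gap_upper_bound {c ℓ k₀ k₁ m₀ m₁ : ℝ} (hc : 0 < c) (hℓ : 0 < ℓ) (hk₀ : 0 < k₀)
    (hk : k₀ < k₁) (hkℓ : k₁ < Real.pi / ℓ) (hm₀ : c ≤ m₀) (hm₁ : 0 < m₁)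
    (h₀ : k₀ * ℓ + Real.arctan (k₀ / m₀) = Real.pi)
    (h₁ : k₁ * ℓ + Real.arctan (k₁ / m₁) = Real.pi) :
    k₁ ^ 2 - k₀ ^ 2 ≤ 2 * Real.pi ^ 2 / c / ℓ ^ 3 := by
  have hm0 : 0 < m₀ := hc.trans_le hm₀
  have h2 : (k₁ - k₀) * ℓ ≤ Real.pi / ℓ / c := by
    have h3 : 0 ≤ Real.arctan (k₁ / m₁) := Real.arctan_nonneg.2 (by have := hk₀.trans hk; positivity)
    have h4 : Real.arctan (k₀ / m₀) ≤ k₀ / m₀ := arctan_le_self (by positivity)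
    have h5 : k₀ / m₀ ≤ Real.pi / ℓ / c :=
      div_le_div₀ (by positivity) (hk.trans hkℓ).le hc hm₀
    linarith
  have h6 : k₁ - k₀ ≤ Real.pi / ℓ / c / ℓ := (le_div_iff₀ hℓ).2 h2
  calc k₁ ^ 2 - k₀ ^ 2 = (k₁ - k₀) * (k₁ + k₀) := by ring
    _ ≤ (Real.pi / ℓ / c / ℓ) * (Real.pi / ℓ + Real.pi / ℓ) :=
        mul_le_mul h6 (by linarith) (by linarith) (by positivity)
    _ = 2 * Real.pi ^ 2 / c / ℓ ^ 3 := by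
        field_simp
        ring

/-- The constants `A' < B'` separate the two slopes near `k = 0`; the hypothesis `hkA` absorbs the
cubic error of `arctan (k₀ / A)` into `A'`. -/
theorem gap_lower_bound {A A' B' ℓ k₀ k₁ m₀ m₁ : ℝ} (hA : 0 < A) (hA' : 0 < A') (hAB : A' < B')
    (hℓ : 1 / B' ≤ ℓ) (hk₀ : 0 < k₀) (hk : k₀ < k₁) (hm0 : 0 < m₀)
    (hm₀ : m₀ ≤ A) (hm₁ : B' ≤ m₁) (hkA : A * (1 + (k₀ / A) ^ 2) ≤ A')
    (h₀ : k₀ * ℓ + Real.arctan (k₀ / m₀) = Real.pi)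
    (h₁ : k₁ * ℓ + Real.arctan (k₁ / m₁) = Real.pi) :
    (1 / A' - 1 / B') / 2 / ℓ ^ 3 ≤ k₁ ^ 2 - k₀ ^ 2 := by
  have hB : 0 < B' := hA'.trans hAB
  have hℓ0 : 0 < ℓ := (by positivity : 0 < 1 / B').trans_le hℓ
  have hd : 0 < 1 / A' - 1 / B' := sub_pos.2 (one_div_lt_one_div_of_lt hA' hAB)
  have e1 : k₀ / A' ≤ Real.arctan (k₀ / m₀) := by
    calc k₀ / A' ≤ k₀ / (A * (1 + (k₀ / A) ^ 2)) :=
          div_le_div_of_nonneg_left hk₀.le (by positivity) hkA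
      _ = k₀ / A / (1 + (k₀ / A) ^ 2) := by rw [div_div]
      _ ≤ Real.arctan (k₀ / A) := div_one_add_sq_le_arctan (by positivity)
      _ ≤ Real.arctan (k₀ / m₀) :=
          Real.arctan_strictMono.monotone (div_le_div_of_nonneg_left hk₀.le hm0 hm₀)
  have hk1 : 0 < k₁ := hk₀.trans hk
  have e2 : Real.arctan (k₁ / m₁) ≤ k₁ / B' :=
    (arctan_le_self (by have := hB.trans_le hm₁; positivity)).trans
      (div_le_div_of_nonneg_left hk1.le hB hm₁)
  -- The phase shift is below `π / 2`, which leaves at least `π / 2 > 1` for `k₀ ℓ`.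
  have e3 : 1 ≤ k₀ * ℓ := by
    linarith [Real.arctan_lt_pi_div_two (k₀ / m₀), Real.pi_gt_three]
  have e4 : k₀ * (1 / A' - 1 / B') ≤ (k₁ - k₀) * (ℓ + 1 / B') := by
    have : (k₁ - k₀) * ℓ ≥ k₀ / A' - k₁ / B' := by linarith
    calc k₀ * (1 / A' - 1 / B') = (k₀ / A' - k₁ / B') + (k₁ - k₀) * (1 / B') := by ring
      _ ≤ (k₁ - k₀) * ℓ + (k₁ - k₀) * (1 / B') := by linarith
      _ = _ := by ring
  have e5 : k₀ * (1 / A' - 1 / B') ≤ (k₁ - k₀) * (2 * ℓ) :=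
    e4.trans (mul_le_mul_of_nonneg_left (by linarith) (by linarith))
  have e6 : 1 / A' - 1 / B' ≤ (k₁ - k₀) * (2 * ℓ ^ 2) := by
    calc 1 / A' - 1 / B' ≤ (k₀ * ℓ) * (1 / A' - 1 / B') := le_mul_of_one_le_left hd.le e3
      _ = k₀ * (1 / A' - 1 / B') * ℓ := by ring
      _ ≤ (k₁ - k₀) * (2 * ℓ) * ℓ := mul_le_mul_of_nonneg_right e5 hℓ0.le
      _ = _ := by ring
  rw [div_le_iff₀ (by positivity), div_le_iff₀ two_pos]
  calc 1 / A' - 1 / B' ≤ (k₁ - k₀) * (2 * ℓ ^ 2) := e6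
    _ ≤ (k₁ - k₀) * (2 * ℓ ^ 2) * (k₀ * ℓ) :=
        le_mul_of_one_le_right (mul_nonneg (by linarith) (by positivity)) e3
    _ ≤ (k₁ - k₀) * (2 * ℓ ^ 2) * ((k₁ + k₀) * ℓ) := by
        refine mul_le_mul_of_nonneg_left ?_ (mul_nonneg (by linarith) (by positivity))
        exact mul_le_mul_of_nonneg_right (by linarith) hℓ0.le
    _ = (k₁ ^ 2 - k₀ ^ 2) * ℓ ^ 3 * 2 := by ring

/-! ### The slopes at the edge of the barrier -/

theorem tanh_pos {x : ℝ} (hx : 0 < x) : 0 < Real.tanh x := by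
  rw [Real.tanh_eq_sinh_div_cosh]
  exact div_pos (Real.sinh_pos_iff.2 hx) (Real.cosh_pos x)

theorem tanh_strictMono : StrictMono Real.tanh := fun x y h =>
  (Real.artanh_lt_artanh_iff ⟨Real.neg_one_lt_tanh x, Real.tanh_lt_one x⟩
    ⟨Real.neg_one_lt_tanh y, Real.tanh_lt_one y⟩).1 (by rwa [Real.artanh_tanh, Real.artanh_tanh])

/-- The logarithmic derivative at `b` of the even solution `cosh (κ x)` in the barrier, where
`κ = √(v₀ - k²)`. -/
def evenSlope (v₀ b k : ℝ) : ℝ := √(v₀ - k ^ 2) * Real.tanh (√(v₀ - k ^ 2) * b)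

/-- The logarithmic derivative at `b` of the odd solution `sinh (κ x)` in the barrier, where
`κ = √(v₀ - k²)`. -/
def oddSlope (v₀ b k : ℝ) : ℝ := √(v₀ - k ^ 2) / Real.tanh (√(v₀ - k ^ 2) * b)

theorem monotoneOn_div_tanh : MonotoneOn (fun x => x / Real.tanh x) (Ioi 0) := by
  have hs : ∀ x ∈ Ioi (0 : ℝ), Real.sinh x ≠ 0 := fun x hx => (Real.sinh_pos_iff.2 hx).ne'
  have heq : (fun x => x / Real.tanh x) = fun x => x * Real.cosh x / Real.sinh x := by
    funext x
    rw [Real.tanh_eq_sinh_div_cosh, div_div_eq_mul_div]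
  rw [heq]
  have hd : ∀ x ∈ Ioi (0 : ℝ), HasDerivAt (fun x => x * Real.cosh x / Real.sinh x)
      (((1 * Real.cosh x + x * Real.sinh x) * Real.sinh x - x * Real.cosh x * Real.cosh x) /
        Real.sinh x ^ 2) x := fun x hx =>
    ((hasDerivAt_id x).fun_mul (Real.hasDerivAt_cosh x)).fun_div (Real.hasDerivAt_sinh x) (hs x hx)
  refine monotoneOn_of_deriv_nonneg (convex_Ioi 0)
    (fun x hx => (hd x hx).continuousAt.continuousWithinAt) ?_ ?_
  · rw [interior_Ioi]
    exact fun x hx => (hd x hx).differentiableAt.differentiableWithinAt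
  · rw [interior_Ioi]
    intro x hx
    rw [(hd x hx).deriv]
    refine div_nonneg ?_ (sq_nonneg _)
    have h1 : x ≤ Real.sinh x := Real.self_le_sinh_iff.2 (le_of_lt hx)
    have h2 := Real.one_le_cosh x
    have h3 := Real.cosh_sq x
    have h4 : 0 < x := hx
    -- The numerator is `cosh x sinh x - x`.
    nlinarith [mul_le_mul h1 h2 zero_le_one (h4.le.trans h1)]

section

variable {v₀ b K : ℝ}

theorem evenSolution_eq_zero_iff {k a : ℝ} (hb : 0 < b) (hk : 0 < k) (hv : k ^ 2 < v₀)
    (ha : b < a) (hka : k < Real.pi / (a - b)) :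
    evenSolution k √(v₀ - k ^ 2) b a = 0 ↔ phase (evenSlope v₀ b) (a - b) k = Real.pi := by
  have hκ : 0 < √(v₀ - k ^ 2) := Real.sqrt_pos.2 (by linarith)
  have hℓ : 0 < a - b := by linarith
  have ht : 0 < Real.tanh (√(v₀ - k ^ 2) * b) := tanh_pos (by positivity)
  have hm : 0 < evenSlope v₀ b k := mul_pos hκ ht
  rw [phase, ← matching_iff hk hm (by positivity)
    ((lt_div_iff₀ hℓ).1 hka), evenSolution_right hb.le ha.le, evenSlope,
    Real.tanh_eq_sinh_div_cosh]
  have hc := Real.cosh_pos (√(v₀ - k ^ 2) * b)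
  rw [← mul_right_inj' (div_pos hk hc).ne', mul_zero]
  apply Eq.congr_left
  field_simp

theorem oddSolution_eq_zero_iff {k a : ℝ} (hb : 0 < b) (hk : 0 < k) (hv : k ^ 2 < v₀)
    (ha : b < a) (hka : k < Real.pi / (a - b)) :
    oddSolution k √(v₀ - k ^ 2) b a = 0 ↔ phase (oddSlope v₀ b) (a - b) k = Real.pi := by
  have hκ : 0 < √(v₀ - k ^ 2) := Real.sqrt_pos.2 (by linarith)
  have hℓ : 0 < a - b := by linarith
  have ht : 0 < Real.tanh (√(v₀ - k ^ 2) * b) := tanh_pos (by positivity)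
  have hm : 0 < oddSlope v₀ b k := div_pos hκ ht
  rw [phase, ← matching_iff hk hm (by positivity)
    ((lt_div_iff₀ hℓ).1 hka), oddSolution_right hb.le ha.le, oddSlope,
    Real.tanh_eq_sinh_div_cosh]
  have hc := Real.cosh_pos (√(v₀ - k ^ 2) * b)
  have hs : 0 < Real.sinh (√(v₀ - k ^ 2) * b) := Real.sinh_pos_iff.2 (by positivity)
  rw [← mul_right_inj' (div_pos (mul_pos hk hκ) hs).ne', mul_zero]
  apply Eq.congr_left
  field_simp

theorem sqrt_sub_sq_pos (hK : K ^ 2 < v₀) {k : ℝ} (hk : k ∈ Icc 0 K) : 0 < √(v₀ - k ^ 2) :=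
  Real.sqrt_pos.2 (by nlinarith [hk.1, hk.2])

theorem tanh_pos_of_mem (hb : 0 < b) (hK : K ^ 2 < v₀) {k : ℝ} (hk : k ∈ Icc 0 K) :
    0 < Real.tanh (√(v₀ - k ^ 2) * b) :=
  tanh_pos (mul_pos (sqrt_sub_sq_pos hK hk) hb)

theorem evenSlope_pos (hb : 0 < b) (hK : K ^ 2 < v₀) {k : ℝ} (hk : k ∈ Icc 0 K) :
    0 < evenSlope v₀ b k :=
  mul_pos (sqrt_sub_sq_pos hK hk) (tanh_pos_of_mem hb hK hk)

theorem evenSlope_lt_oddSlope (hb : 0 < b) (hK : K ^ 2 < v₀) {k : ℝ} (hk : k ∈ Icc 0 K) :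
    evenSlope v₀ b k < oddSlope v₀ b k := by
  have ht := tanh_pos_of_mem hb hK hk
  have h1 := Real.tanh_lt_one (√(v₀ - k ^ 2) * b)
  rw [evenSlope, oddSlope, div_eq_mul_inv]
  exact mul_lt_mul_of_pos_left (h1.trans ((one_lt_inv₀ ht).2 h1)) (sqrt_sub_sq_pos hK hk)

theorem sqrt_sub_sq_antitoneOn : AntitoneOn (fun k => √(v₀ - k ^ 2)) (Icc 0 K) :=
  fun x hx y _ hxy => Real.sqrt_le_sqrt (by nlinarith [hx.1])

theorem evenSlope_antitoneOn (hb : 0 < b) (hK : K ^ 2 < v₀) :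
    AntitoneOn (evenSlope v₀ b) (Icc 0 K) := by
  intro x hx y hy hxy
  have h := sqrt_sub_sq_antitoneOn (v₀ := v₀) hx hy hxy
  refine mul_le_mul h (tanh_strictMono.monotone ?_) (tanh_pos_of_mem hb hK hy).le
    (sqrt_sub_sq_pos hK hx).le
  exact mul_le_mul_of_nonneg_right h hb.le

theorem oddSlope_eq (hb : 0 < b) (k : ℝ) : oddSlope v₀ b k =
    (fun x => x / Real.tanh x) (√(v₀ - k ^ 2) * b) / b := by
  rw [oddSlope]
  field_simp

theorem oddSlope_antitoneOn (hb : 0 < b) (hK : K ^ 2 < v₀) :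
    AntitoneOn (oddSlope v₀ b) (Icc 0 K) := by
  intro x hx y hy hxy
  have h := sqrt_sub_sq_antitoneOn (v₀ := v₀) hx hy hxy
  rw [oddSlope_eq hb, oddSlope_eq hb]
  refine div_le_div_of_nonneg_right (monotoneOn_div_tanh ?_ ?_ ?_) hb.le
  · exact mul_pos (sqrt_sub_sq_pos hK hy) hb
  · exact mul_pos (sqrt_sub_sq_pos hK hx) hb
  · exact mul_le_mul_of_nonneg_right h hb.le

theorem continuous_evenSlope : Continuous (evenSlope v₀ b) := by
  unfold evenSlope
  simp only [Real.tanh_eq_sinh_div_cosh]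
  refine Continuous.mul (by fun_prop) (Continuous.div (by fun_prop) (by fun_prop) fun k =>
    (Real.cosh_pos _).ne')

theorem continuousAt_oddSlope (hb : 0 < b) {k : ℝ} (hk : k ^ 2 < v₀) :
    ContinuousAt (oddSlope v₀ b) k := by
  have h : Continuous fun k => Real.tanh (√(v₀ - k ^ 2) * b) := by
    simp only [Real.tanh_eq_sinh_div_cosh]
    exact Continuous.div (by fun_prop) (by fun_prop) fun k => (Real.cosh_pos _).ne'
  exact ContinuousAt.div (by fun_prop) h.continuousAt
    (tanh_pos (mul_pos (Real.sqrt_pos.2 (by linarith)) hb)).ne'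

end

/-! ### The two lowest eigenvalues and the spectral gap -/

open Filter Topology in
/-- The two slopes are separated at `k = 0`, where they are `κ tanh (κ b) < κ / tanh (κ b)`, and
hence, by continuity and monotonicity, uniformly on some interval `[0, K]`. -/
theorem exists_uniform_slope_bounds {v₀ b : ℝ} (hv₀ : 0 < v₀) (hb : 0 < b) :
    ∃ K A A' B' : ℝ, 0 < K ∧ K ^ 2 < v₀ ∧ 0 < A ∧ 0 < A' ∧ A' < B' ∧
      ∀ k ∈ Icc 0 K, evenSlope v₀ b k ≤ A ∧ B' ≤ oddSlope v₀ b k ∧ A * (1 + (k / A) ^ 2) ≤ A' := by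
  have h00 : (0 : ℝ) ^ 2 < v₀ := by simpa using hv₀
  have hmem : (0 : ℝ) ∈ Icc (0 : ℝ) 0 := ⟨le_rfl, le_rfl⟩
  have hA : 0 < evenSlope v₀ b 0 := evenSlope_pos hb h00 hmem
  obtain ⟨A', hA1, hA2⟩ := exists_between (evenSlope_lt_oddSlope hb h00 hmem)
  obtain ⟨B', hB1, hB2⟩ := exists_between hA2
  have e1 : ∀ᶠ k in 𝓝 (0 : ℝ), k ^ 2 < v₀ :=
    (continuous_pow 2).continuousAt.eventually_lt continuousAt_const h00
  have e2 : ∀ᶠ k in 𝓝 (0 : ℝ), B' < oddSlope v₀ b k :=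
    continuousAt_const.eventually_lt (continuousAt_oddSlope hb h00) hB2
  have e3 : ∀ᶠ k in 𝓝 (0 : ℝ), evenSlope v₀ b 0 * (1 + (k / evenSlope v₀ b 0) ^ 2) < A' :=
    ContinuousAt.eventually_lt (by fun_prop) continuousAt_const (by simpa using hA1)
  obtain ⟨K, ⟨h1, h2, h3⟩, hK⟩ := (((e1.and (e2.and e3)).filter_mono nhdsWithin_le_nhds).and
    (self_mem_nhdsWithin : Ioi (0 : ℝ) ∈ 𝓝[>] 0)).exists
  have hK0 : 0 < K := hK
  refine ⟨K, evenSlope v₀ b 0, A', B', hK0, h1, hA, hA.trans hA1, hB1, fun k hk => ⟨?_, ?_, ?_⟩⟩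
  · exact evenSlope_antitoneOn hb h1 ⟨le_rfl, hK0.le⟩ hk hk.1
  · exact h2.le.trans (oddSlope_antitoneOn hb h1 hk ⟨hK0.le, le_rfl⟩ hk.2)
  · refine le_trans ?_ h3.le
    have := hk.1
    have := hk.2
    gcongr

/-- Once `π / ℓ ≤ K < √v₀` for `ℓ = L/2 - b`, the two lowest eigenvalues are `k₀²` and `k₁²`, where
`k₀` and `k₁` in `(0, π / ℓ)` solve the even and the odd phase condition. -/
theorem exists_lowest_energies {v₀ b K L : ℝ} (hb : 0 < b) (hK : K ^ 2 < v₀)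
    (hL : b < L / 2) (hKL : Real.pi / (L / 2 - b) ≤ K) :
    ∃ k₀ k₁ : ℝ, 0 < k₀ ∧ k₀ < k₁ ∧ k₁ < Real.pi / (L / 2 - b) ∧
      phase (evenSlope v₀ b) (L / 2 - b) k₀ = Real.pi ∧
      phase (oddSlope v₀ b) (L / 2 - b) k₁ = Real.pi ∧
      energiesAbove (dirichletSchrodinger (stepPotential v₀ b) L) 0 = Ici (k₀ ^ 2) ∧
      energiesAbove (dirichletSchrodinger (stepPotential v₀ b) L) 1 = Ici (k₁ ^ 2) := by
  have hℓ : 0 < L / 2 - b := by linarith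
  have hpos := fun k hk => evenSlope_pos (v₀ := v₀) (K := K) (k := k) hb hK hk
  have hlt := fun k hk => evenSlope_lt_oddSlope (v₀ := v₀) (K := K) (k := k) hb hK hk
  have hpos' := fun k hk => (hpos k hk).trans (hlt k hk)
  have hsq : ∀ k ∈ Icc 0 K, k ^ 2 < v₀ := fun k hk =>
    lt_of_le_of_lt (pow_le_pow_left₀ hk.1 hk.2 2) hK
  obtain ⟨k₀, ⟨h₀, h₀'⟩, hk₀⟩ := exists_phase_eq_pi hℓ hKL
    continuous_evenSlope.continuousOn hpos
  obtain ⟨k₁, ⟨h₁, h₁'⟩, hk₁⟩ := exists_phase_eq_pi hℓ hKL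
    (fun k hk => (continuousAt_oddSlope hb (hsq k hk)).continuousWithinAt) hpos'
  have m₀ : k₀ ∈ Icc 0 K := ⟨h₀.le, h₀'.le.trans hKL⟩
  have m₁ : k₁ ∈ Icc 0 K := ⟨h₁.le, h₁'.le.trans hKL⟩
  have mono_e := phase_strictMonoOn hℓ (evenSlope_antitoneOn hb hK) hpos
  have mono_o := phase_strictMonoOn hℓ (oddSlope_antitoneOn hb hK) hpos'
  have hk : k₀ < k₁ := by
    rw [← mono_e.lt_iff_lt m₀ m₁, hk₀, ← hk₁]
    exact phase_lt_phase h₁ (hpos _ m₁) (hlt _ m₁)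
  have odd_ne : ∀ k, 0 < k → k < k₁ → oddSolution k √(v₀ - k ^ 2) b (L / 2) ≠ 0 := by
    intro k hk0 hkk
    have m : k ∈ Icc 0 K := ⟨hk0.le, hkk.le.trans m₁.2⟩
    rw [Ne, oddSolution_eq_zero_iff hb hk0 (hsq k m) hL (hkk.trans h₁'), ← hk₁]
    exact (mono_o m m₁ hkk).ne
  have hκ : ∀ k ∈ Icc 0 K, √(v₀ - k ^ 2) ≠ 0 ∧ √(v₀ - k ^ 2) ^ 2 = v₀ - k ^ 2 := fun k hk =>
    ⟨(sqrt_sub_sq_pos hK hk).ne', Real.sq_sqrt (by linarith [hsq k hk])⟩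
  obtain ⟨f₀, hf₀, hspan⟩ := exists_eigenspace_eq_span h₀.ne' (hκ _ m₀).1 hb (hκ _ m₀).2 hL.le
    ((evenSolution_eq_zero_iff hb h₀ (hsq _ m₀) hL h₀').2 hk₀) (odd_ne k₀ h₀ hk)
  obtain ⟨f₁, hmem, hf₁⟩ := exists_mem_eigenspace_of_oddSolution_eq_zero h₁.ne' (hκ _ m₁).1 hb
    (hκ _ m₁).2 hL.le ((oddSolution_eq_zero_iff hb h₁ (hsq _ m₁) hL h₁').2 hk₁)
  have hbot : ∀ x < k₁ ^ 2, x ≠ k₀ ^ 2 →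
      (dirichletSchrodinger (stepPotential v₀ b) L).eigenspace (x : ℂ) = ⊥ := by
    intro x hx hx₀
    rcases le_or_gt x 0 with hx0 | hx0
    · exact eigenspace_eq_bot_of_nonpos (by linarith)
        (stepPotential_nonneg ((sq_nonneg _).trans hK.le)) hx0
    obtain ⟨k, hk0, rfl⟩ : ∃ k, 0 < k ∧ k ^ 2 = x :=
      ⟨√x, Real.sqrt_pos.2 hx0, Real.sq_sqrt hx0.le⟩
    have hkk : k < k₁ := lt_of_pow_lt_pow_left₀ 2 h₁.le hx
    have m : k ∈ Icc 0 K := ⟨hk0.le, hkk.le.trans m₁.2⟩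
    refine eigenspace_eq_bot_of_ne_zero hk0.ne' (hκ _ m).1 hb (hκ _ m).2 hL.le ?_
      (odd_ne k hk0 hkk)
    rw [Ne, evenSolution_eq_zero_iff hb hk0 (hsq k m) hL (hkk.trans h₁'), ← hk₀,
      mono_e.injOn.eq_iff m m₀]
    rintro rfl
    exact hx₀ rfl
  have hE : k₀ ^ 2 < k₁ ^ 2 := pow_lt_pow_left₀ hk h₀.le two_ne_zero
  exact ⟨k₀, k₁, h₀, hk, h₁', hk₀, hk₁,
    energiesAbove_zero_eq hspan hf₀ fun x hx => hbot x (hx.trans hE) hx.ne,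
    energiesAbove_one_eq hspan hf₀ hmem hf₁ hE hbot⟩

end
theorem mainTheorem5 (v₀ b : ℝ) (hv₀ : 0 < v₀) (hb : 0 < b) :
    ∃ α β L₀ : ℝ, 0 < α ∧ 0 < β ∧ 0 < L₀ ∧ ∀ L : ℝ, L₀ ≤ L →
      -- the two lowest eigenvalues exist
      (∀ n : ℕ, n ≤ 1 → IsLeast (energiesAbove (dirichletSchrodinger (stepPotential v₀ b) L) n)
        (dirichletEigenvalue (stepPotential v₀ b) L n)) ∧
      α / L ^ 3 ≤ spectralGap (stepPotential v₀ b) L ∧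
      spectralGap (stepPotential v₀ b) L ≤ β / L ^ 3 := by
  obtain ⟨K, A, A', B', hK0, hK, hA, hA', hAB, hbd⟩ := exists_uniform_slope_bounds hv₀ hb
  have hB' : 0 < B' := hA'.trans hAB
  have hc : 0 < evenSlope v₀ b K := evenSlope_pos hb hK ⟨hK0.le, le_rfl⟩
  have hd : 0 < 1 / A' - 1 / B' := sub_pos.2 (one_div_lt_one_div_of_lt hA' hAB)
  -- The three summands of `L₀` give `ℓ ≥ L / 4`, `π / ℓ ≤ K` and `1 / B' ≤ ℓ` for `ℓ = L / 2 - b`.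
  refine ⟨(1 / A' - 1 / B') / 2, 2 * Real.pi ^ 2 / evenSlope v₀ b K * 4 ^ 3,
    4 * b + 4 * (Real.pi / K) + 4 * (1 / B'), by positivity, by positivity, by positivity,
    fun L hL => ?_⟩
  have p1 : 0 < Real.pi / K := by positivity
  have p2 : 0 < 1 / B' := by positivity
  have hL0 : 0 < L := by linarith
  have hℓ0 : 0 < L / 2 - b := by linarith
  have hKL : Real.pi / (L / 2 - b) ≤ K := by
    rw [div_le_iff₀ hℓ0, mul_comm, ← div_le_iff₀ hK0]
    linarith
  obtain ⟨k₀, k₁, h₀, hk, h₁, hk₀, hk₁, hE₀, hE₁⟩ :=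
    exists_lowest_energies hb hK (by linarith) hKL
  have m₀ : k₀ ∈ Set.Icc 0 K := ⟨h₀.le, (hk.trans h₁).le.trans hKL⟩
  have m₁ : k₁ ∈ Set.Icc 0 K := ⟨(h₀.trans hk).le, h₁.le.trans hKL⟩
  have hgap : spectralGap (stepPotential v₀ b) L = k₁ ^ 2 - k₀ ^ 2 := by
    rw [spectralGap, dirichletEigenvalue, dirichletEigenvalue, hE₀, hE₁, csInf_Ici, csInf_Ici]
  refine ⟨fun n hn => ?_, ?_, ?_⟩
  · interval_cases n
    · rw [dirichletEigenvalue, hE₀, csInf_Ici]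
      exact isLeast_Ici
    · rw [dirichletEigenvalue, hE₁, csInf_Ici]
      exact isLeast_Ici
  · rw [hgap]
    refine le_trans ?_ (gap_lower_bound (ℓ := L / 2 - b) hA hA' hAB (by linarith) h₀ hk
      (evenSlope_pos hb hK m₀) (hbd k₀ m₀).1 (hbd k₁ m₁).2.1 (hbd k₀ m₀).2.2 hk₀ hk₁)
    have : L / 2 - b ≤ L := by linarith
    gcongr
  · rw [hgap]
    refine (gap_upper_bound hc hℓ0 h₀ hk h₁
      (evenSlope_antitoneOn hb hK m₀ ⟨hK0.le, le_rfl⟩ m₀.2)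
      ((evenSlope_pos hb hK m₁).trans (evenSlope_lt_oddSlope hb hK m₁)) hk₀ hk₁).trans ?_
    have h4 : L / 4 ≤ L / 2 - b := by linarith
    calc 2 * Real.pi ^ 2 / evenSlope v₀ b K / (L / 2 - b) ^ 3
        ≤ 2 * Real.pi ^ 2 / evenSlope v₀ b K / (L / 4) ^ 3 := by gcongr
      _ = 2 * Real.pi ^ 2 / evenSlope v₀ b K * 4 ^ 3 / L ^ 3 := by
        rw [div_pow, div_div_eq_mul_div]
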